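/- Let $p\ge 0$ and let $A=QSQ^\top\in\mathbb R^{2p\times 2p}$ be a real Schur decomposition of a normal matrix, with $Q$ orthogonal and $S$ block diagonal with $2\times2$ blocks $\lambda_j\begin{bmatrix}c_j&-s_j\\ s_j&c_j\end{bmatrix}$, where $c_j=\cos\theta_j$, $s_j=\sin\theta_j$, $\lambda_j>0$, $\theta_j\in(0,\pi)$, $j=1,\dots,p$ (so the eigenvalues of $A$ are $\lambda_je^{\pm i\theta_j}$). Put $\Omega=\tfrac12(A-A^\top)$. Let $\sigma,\tau\in\mathbb R$, and let $\mathcal J\subseteq\{1,\dots,p\}$ be such that $\lambda_js_j=\sigma$ for all $j\in\mathcal J$ and $\lambda_is_i\ne\sigma$ for all $i\in\mathcal I:=\{1,\dots,p\}\setminus\mathcal J$. Let $m=|\mathcal J|$, let $D_m$ be a diagonal matrix whose diagonal entries are the numbers $\lambda_jc_j$, $j\in\mathcal J$, listed in any order, and let $J_2=\begin{bmatrix}0&-1\\1&0\end{bmatrix}$. Let $\mathrm{St}(2p,2m)=\{V\in\mathbb R^{2p\times 2m}: V^\top V=I_{2m}\}$ and let $\mathrm{OSp}(2m)$ be the set of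 orthogonal $2m\times2m$ matrices that commute with $J_2\otimes I_m=\begin{bmatrix}0&-I_m\\I_m&0\end{bmatrix}$. For every $\varepsilon>0$ and every $V\in\mathrm{St}(2p,2m)$ with $$\|\Omega V-V\sigma(J_2\otimes I_m)\|_{\mathrm F}\le\tau\varepsilon\|A\|_{\mathrm F},$$ one has $$\min_{R\in\mathrm{OSp}(2m)}\left\|A(VR)-(VR)\begin{bmatrix}D_m&-\sigma I_m\\ \sigma I_m&D_m\end{bmatrix}\right\|_{\mathrm F}\le\tau\varepsilon\|A\|_{\mathrm F}\left(1+\frac{\max_{i\in\mathcal I,\,j\in\mathcal J}|\lambda_ic_i-\lambda_jc_j|}{\min_{i\in\mathcal I}|\lambda_is_i-\sigma|}+\frac{\max_{j_1,j_2\in\mathcal J}|\lambda_{j_1}c_{j_1}-\lambda_{j_2}c_{j_2}|}{\sigma}\right)+r(\varepsilon),$$ where $r(\varepsilon)=o(\varepsilon)$ as $\varepsilon\to0^+$, and the function $r$ depends only on $(\lambda_j)_j$, $(\theta_j)_j$, $\mathcal J$, $\sigma$ and $\tau$ (in particular not on $V$). A quotient whose numerator is a maximum over an empty set is read as $0$.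 -/

import Mathlib

open Filter Topology Asymptotics
open scoped Kronecker Matrix

-- `‖M‖` is the Frobenius norm of the real matrix `M`.
attribute [local instance] Matrix.frobeniusNormedAddCommGroup

noncomputable section

namespace NormalEVP

/-- The rotation generator `J₂ = [[0, -1], [1, 0]]`. -/
def J2 : Matrix (Fin 2) (Fin 2) ℝ := !![0, -1; 1, 0]

/-- The position of entry `k` of block `j` among `0, …, 2p - 1`, namely `2 * j + k`. -/
def blockIndex (p : ℕ) : Fin p × Fin 2 ≃ Fin (2 * p) :=
  finProdFinEquiv.trans (finCongr (Nat.mul_comm p 2))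

/-- The real Schur form `S = Λ cos Θ ⊗ I₂ + Λ sin Θ ⊗ J₂`, block diagonal with `2 × 2` blocks
`λⱼ [[cos θⱼ, -sin θⱼ], [sin θⱼ, cos θⱼ]]`. -/
def schurForm {p : ℕ} (lam θ : Fin p → ℝ) : Matrix (Fin (2 * p)) (Fin (2 * p)) ℝ :=
  Matrix.reindex (blockIndex p) (blockIndex p)
    (Matrix.diagonal (fun j => lam j * Real.cos (θ j)) ⊗ₖ (1 : Matrix (Fin 2) (Fin 2) ℝ) +
      Matrix.diagonal (fun j => lam j * Real.sin (θ j)) ⊗ₖ J2)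

/-- `A = Q S Qᵀ` is a real Schur decomposition with `Q` orthogonal and `S` the real Schur form
with eigenvalues `λⱼ e^{± i θⱼ}`, `λⱼ > 0`, `θⱼ ∈ (0, π)`. -/
structure IsRSD {p : ℕ} (A Q : Matrix (Fin (2 * p)) (Fin (2 * p)) ℝ) (lam θ : Fin p → ℝ) :
    Prop where
  lam_pos : ∀ j, 0 < lam j
  angle_mem : ∀ j, θ j ∈ Set.Ioo 0 Real.pi
  orthogonal : Q ∈ Matrix.orthogonalGroup (Fin (2 * p)) ℝ
  eq : A = Q * schurForm lam θ * Qᵀ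

/-- The skew-symmetric part `(A - Aᵀ) / 2`. -/
def skewPart {n : Type*} (A : Matrix n n ℝ) : Matrix n n ℝ := (1 / 2 : ℝ) • (A - Aᵀ)

/-- The Stiefel manifold `St(2p, 2m)`; the `2m` columns are split into two groups of `m`. -/
def stiefel (p m : ℕ) : Set (Matrix (Fin (2 * p)) (Fin m ⊕ Fin m) ℝ) := {V | Vᵀ * V = 1}

/-- The matrix `J₂ ⊗ Iₘ = [[0, -I], [I, 0]]`. -/
def bigJ (m : ℕ) : Matrix (Fin m ⊕ Fin m) (Fin m ⊕ Fin m) ℝ := Matrix.fromBlocks 0 (-1) 1 0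

/-- The ortho-symplectic matrices: orthogonal and commuting with `J₂ ⊗ Iₘ`. -/
def OSp (m : ℕ) : Set (Matrix (Fin m ⊕ Fin m) (Fin m ⊕ Fin m) ℝ) :=
  {R | R ∈ Matrix.orthogonalGroup (Fin m ⊕ Fin m) ℝ ∧ R * bigJ m = bigJ m * R}

/-- The matrix `[[D, -σ I], [σ I, D]]` with `D` the diagonal matrix with entries `d`. -/
def targetBlock {m : ℕ} (d : Fin m → ℝ) (σ : ℝ) : Matrix (Fin m ⊕ Fin m) (Fin m ⊕ Fin m) ℝ :=
  Matrix.fromBlocks (Matrix.diagonal d) (-(σ • (1 : Matrix (Fin m) (Fin m) ℝ)))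
    (σ • (1 : Matrix (Fin m) (Fin m) ℝ)) (Matrix.diagonal d)

/-- `max |λᵢ cᵢ - λⱼ cⱼ|` over `i ∉ J`, `j ∈ J` (`0` if there is no such pair). -/
def outerSpread {p : ℕ} (lam θ : Fin p → ℝ) (J : Finset (Fin p)) : ℝ :=
  ⨆ ij : {i // i ∉ J} × {j // j ∈ J},
    |lam ij.1 * Real.cos (θ ij.1) - lam ij.2 * Real.cos (θ ij.2)|

/-- `max |λⱼ₁ cⱼ₁ - λⱼ₂ cⱼ₂|` over `j₁, j₂ ∈ J` (`0` if `J` is empty). -/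
def innerSpread {p : ℕ} (lam θ : Fin p → ℝ) (J : Finset (Fin p)) : ℝ :=
  ⨆ jj : {j // j ∈ J} × {j // j ∈ J},
    |lam jj.1 * Real.cos (θ jj.1) - lam jj.2 * Real.cos (θ jj.2)|

/-- `min |λᵢ sᵢ - σ|` over `i ∉ J`. If every index is in `J`, then this is `0`, and so are
`outerSpread` and the quotient `outerSpread / imagGap`, as it should be. -/
def imagGap {p : ℕ} (lam θ : Fin p → ℝ) (J : Finset (Fin p)) (σ : ℝ) : ℝ :=
  ⨅ i : {i // i ∉ J}, |lam i * Real.sin (θ i) - σ|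

end NormalEVP

end

/-! In Schur coordinates, with the blocks of `J` first, `V` becomes an orthonormal frame with rows
`Y` (blocks in `J`) and `X` (the others), and the residual of `Ω` splits accordingly. On the rows of
`Y` it is `σ` times the commutator of `bigJ` with `Y`, so it controls the part `Z` of `Y`
anticommuting with `bigJ`: `2σ‖Z‖ ≤ δ` (`frobenius_norm_antiPart`). On the rows of `X` it is a
Sylvester operator bounded below by the gap `g`: `g‖X‖ ≤ δ` (`gap_mul_frobenius_norm_le`).

The commuting part `W = Y - Z` is orthogonal up to terms quadratic in `Z` and `X`. The transpose `R`
of its polar factor is ortho-symplectic and `W R = 1 + O(δ²)` (`exists_OSp_frobenius_norm_le`),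
hence `Y R = 1 + Z R + O(δ²)`.

Since `R` commutes with `bigJ`, the residual of `A` at `V R` is that of `Ω` times `R`, plus diagonal
Sylvester terms in `Y R - 1` and `X R`. The latter cost the inner spread times `‖Y R - 1‖` and the
outer spread times `‖X‖`, which gives the three terms of the bound. -/

noncomputable section

namespace NormalEVP

/-! ### Frobenius norm estimates -/

section Frobenius

attribute [local instance] Matrix.frobeniusNormedSpace

variable {a b c : Type*} [Fintype a] [Fintype b] [Fintype c]

lemma frobenius_norm_sq (M : Matrix a b ℝ) : ‖M‖ ^ 2 = ∑ i, ∑ j, M i j ^ 2 := by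
  rw [Matrix.frobenius_norm_def, ← Real.sqrt_eq_rpow, Real.sq_sqrt (by positivity)]
  simp

lemma frobenius_norm_sq_eq_trace (M : Matrix a b ℝ) : ‖M‖ ^ 2 = (Mᵀ * M).trace := by
  rw [frobenius_norm_sq, Finset.sum_comm]
  simp [Matrix.trace, Matrix.mul_apply, pow_two]

lemma frobenius_norm_mul_left [DecidableEq b] (U : Matrix a b ℝ) (hU : Uᵀ * U = 1)
    (M : Matrix b c ℝ) : ‖U * M‖ = ‖M‖ := by
  rw [← sq_eq_sq₀ (norm_nonneg _) (norm_nonneg _), frobenius_norm_sq_eq_trace,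
    frobenius_norm_sq_eq_trace, Matrix.transpose_mul, Matrix.mul_assoc, ← Matrix.mul_assoc Uᵀ, hU,
    Matrix.one_mul]

lemma frobenius_norm_mul_right [DecidableEq b] (U : Matrix b a ℝ) (hU : U * Uᵀ = 1)
    (M : Matrix c b ℝ) : ‖M * U‖ = ‖M‖ := by
  rw [← Matrix.frobenius_norm_transpose, Matrix.transpose_mul,
    frobenius_norm_mul_left _ (by simpa using hU), Matrix.frobenius_norm_transpose]

lemma frobenius_norm_transpose_mul_self_le (M : Matrix a b ℝ) : ‖Mᵀ * M‖ ≤ ‖M‖ ^ 2 := by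
  have := Matrix.frobenius_norm_mul Mᵀ M
  rwa [Matrix.frobenius_norm_transpose, ← pow_two] at this

lemma frobenius_norm_sq_fromRows (Y : Matrix a c ℝ) (X : Matrix b c ℝ) :
    ‖Matrix.fromRows Y X‖ ^ 2 = ‖Y‖ ^ 2 + ‖X‖ ^ 2 := by
  simp [frobenius_norm_sq]

lemma frobenius_norm_fromRows_le (Y : Matrix a c ℝ) (X : Matrix b c ℝ) :
    ‖Matrix.fromRows Y X‖ ≤ ‖Y‖ + ‖X‖ := by
  refine le_of_sq_le_sq ?_ (by positivity)
  nlinarith [frobenius_norm_sq_fromRows Y X, norm_nonneg Y, norm_nonneg X,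
    mul_nonneg (norm_nonneg Y) (norm_nonneg X)]

lemma frobenius_norm_le_of_sq_le (X : Matrix a b ℝ) (Y : Matrix a b ℝ) {s : ℝ} (hs : 0 ≤ s)
    (h : ∀ i j, |Y i j| ≤ s * |X i j|) : ‖Y‖ ≤ s * ‖X‖ := by
  rw [← pow_le_pow_iff_left₀ (norm_nonneg _) (by positivity) two_ne_zero, mul_pow,
    frobenius_norm_sq, frobenius_norm_sq, Finset.mul_sum]
  refine Finset.sum_le_sum fun i _ => ?_
  rw [Finset.mul_sum]
  refine Finset.sum_le_sum fun j _ => ?_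
  rw [← mul_pow, sq_le_sq, abs_mul, abs_of_nonneg hs]
  exact h i j

lemma frobenius_norm_diagonal_sub_le [DecidableEq a] [DecidableEq b] (u : a → ℝ) (v : b → ℝ)
    (X : Matrix a b ℝ) {s : ℝ} (hs : 0 ≤ s) (h : ∀ i j, |u i - v j| ≤ s) :
    ‖Matrix.diagonal u * X - X * Matrix.diagonal v‖ ≤ s * ‖X‖ := by
  refine frobenius_norm_le_of_sq_le _ _ hs fun i j => ?_
  have : (Matrix.diagonal u * X - X * Matrix.diagonal v) i j = (u i - v j) * X i j := by
    simp; ring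
  rw [this, abs_mul]
  exact mul_le_mul_of_nonneg_right (h i j) (abs_nonneg _)

/-- With `X = H - 1` one has `H² - 1 = H X + X`, and the cross term of the squared norm is `2 tr(X H
X) ≥ 0`. -/
lemma frobenius_norm_sub_one_le_of_posSemidef [DecidableEq a] {H : Matrix a a ℝ}
    (hH : H.PosSemidef) : ‖H - 1‖ ≤ ‖H * H - 1‖ := by
  have hT : Hᵀ = H := by simpa using hH.isHermitian.eq
  set X := H - 1 with hX
  have hXT : Xᵀ = X := by simp [hX, hT]
  have e1 : H * H - 1 = H * X + X := by simp only [hX]; noncomm_ring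
  have h1 : 0 ≤ (X * H * X).trace := by
    have := (hH.conjTranspose_mul_mul_same X).trace_nonneg
    simpa [hXT] using this
  have e2 : ‖H * X + X‖ ^ 2 = ‖H * X‖ ^ 2 + ‖X‖ ^ 2 + 2 * (X * H * X).trace := by
    simp only [frobenius_norm_sq_eq_trace, Matrix.transpose_add, Matrix.transpose_mul, hXT, hT,
      Matrix.add_mul, Matrix.mul_add, Matrix.trace_add, Matrix.mul_assoc]
    ring
  rw [← pow_le_pow_iff_left₀ (norm_nonneg _) (norm_nonneg _) two_ne_zero, e1, e2]
  nlinarith [sq_nonneg ‖H * X‖]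

end Frobenius

/-! ### Ortho-symplectic matrices and the polar factor -/

section Polar

lemma transpose_bigJ (m : ℕ) : (bigJ m)ᵀ = -bigJ m := by
  simp [bigJ, Matrix.fromBlocks_transpose, Matrix.fromBlocks_neg]

lemma bigJ_mul_bigJ (m : ℕ) : bigJ m * bigJ m = -1 := by
  rw [bigJ, Matrix.fromBlocks_multiply, ← Matrix.fromBlocks_one, Matrix.fromBlocks_neg]
  simp

lemma one_mem_OSp (m : ℕ) : (1 : Matrix (Fin m ⊕ Fin m) (Fin m ⊕ Fin m) ℝ) ∈ OSp m :=
  ⟨one_mem _, by simp⟩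

lemma isCompact_OSp (m : ℕ) : IsCompact (OSp m) := by
  have hK : IsCompact (Set.pi Set.univ fun _ : Fin m ⊕ Fin m =>
      Set.pi Set.univ fun _ : Fin m ⊕ Fin m => Set.Icc (-1 : ℝ) 1) :=
    isCompact_univ_pi fun _ => isCompact_univ_pi fun _ => isCompact_Icc
  refine hK.of_isClosed_subset ?_ ?_
  · have : OSp m = {R | Rᵀ * R = 1} ∩ {R | R * bigJ m = bigJ m * R} := by
      ext R
      simp [OSp, Matrix.mem_orthogonalGroup_iff']
    rw [this]
    exact (isClosed_eq (by fun_prop) (by fun_prop)).inter (isClosed_eq (by fun_prop) (by fun_prop))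
  · rintro R ⟨hR, -⟩ i - j -
    have := entry_norm_bound_of_unitary hR i j
    exact abs_le.mp this

/-- A kernel vector, seen as a one-column matrix `N`, would satisfy `(G - 1) N = -N`, against
submultiplicativity. -/
lemma isUnit_of_frobenius_norm_sub_one_lt {a : Type*} [Fintype a] [DecidableEq a]
    {G : Matrix a a ℝ} (h : ‖G - 1‖ < 1) : IsUnit G := by
  rw [Matrix.isUnit_iff_isUnit_det, isUnit_iff_ne_zero]
  intro h0
  obtain ⟨v, hv, hGv⟩ := Matrix.exists_mulVec_eq_zero_iff.mpr h0
  set N := Matrix.replicateCol Unit v with hN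
  have hGN : G * N = 0 := by rw [hN, ← Matrix.replicateCol_mulVec, hGv]; rfl
  have h1 : (G - 1) * N = -N := by rw [Matrix.sub_mul, hGN, Matrix.one_mul, zero_sub]
  have h2 := Matrix.frobenius_norm_mul (G - 1) N
  rw [h1, norm_neg] at h2
  have h3 : N ≠ 0 := fun hN0 => hv <| funext fun i => congrFun (congrFun hN0 i) ()
  nlinarith [norm_pos_iff.mpr h3]

open scoped MatrixOrder in
-- Polar decomposition `W = U H` with `H = (WᵀW)^{1/2}` and `R = Uᵀ`. Then `W R - 1 = U (H - 1) Uᵀ`,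
-- whose norm is `‖H - 1‖ ≤ ‖H² - 1‖`.
lemma exists_OSp_frobenius_norm_mul_sub_one_le {m : ℕ}
    {W : Matrix (Fin m ⊕ Fin m) (Fin m ⊕ Fin m) ℝ} (hW : W * bigJ m = bigJ m * W)
    (h : ‖Wᵀ * W - 1‖ < 1) : ∃ R ∈ OSp m, ‖W * R - 1‖ ≤ ‖Wᵀ * W - 1‖ := by
  have hG : (Wᵀ * W).PosSemidef := by
    simpa using Matrix.posSemidef_conjTranspose_mul_self W
  set H := CFC.sqrt (Wᵀ * W) with hHdef
  have hH : H.PosSemidef := Matrix.nonneg_iff_posSemidef.mp (CFC.sqrt_nonneg _)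
  have hHH : H * H = Wᵀ * W := CFC.sqrt_mul_sqrt_self _ (Matrix.nonneg_iff_posSemidef.mpr hG)
  have hT : Hᵀ = H := by simpa using hH.isHermitian.eq
  have hu : IsUnit H := by
    have := isUnit_of_frobenius_norm_sub_one_lt h
    rw [← hHH] at this
    exact isUnit_of_mul_isUnit_left this
  have hd : IsUnit H.det := (Matrix.isUnit_iff_isUnit_det H).mp hu
  have hJJ := bigJ_mul_bigJ m
  have hJT := transpose_bigJ m
  have hWT : bigJ m * Wᵀ = Wᵀ * bigJ m := by
    have := congrArg Matrix.transpose hW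
    simpa [Matrix.transpose_mul, hJT] using this
  have hHJ : H * bigJ m = bigJ m * H := by
    -- Conjugation by the orthogonal matrix `bigJ m` fixes `WᵀW`, hence also its unique positive
    -- semidefinite square root.
    have h1 : CFC.sqrt (Wᵀ * W) = (bigJ m)ᵀ * H * bigJ m := by
      refine CFC.sqrt_unique ?_ (Matrix.nonneg_iff_posSemidef.mpr ?_)
      · calc (bigJ m)ᵀ * H * bigJ m * ((bigJ m)ᵀ * H * bigJ m)
            = bigJ m * H * (bigJ m * bigJ m) * H * bigJ m := by rw [hJT]; noncomm_ring
          _ = -(bigJ m * (H * H) * bigJ m) := by rw [hJJ]; noncomm_ring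
          _ = -((bigJ m * Wᵀ) * (W * bigJ m)) := by rw [hHH]; noncomm_ring
          _ = -(Wᵀ * (bigJ m * bigJ m) * W) := by rw [hWT, hW]; noncomm_ring
          _ = Wᵀ * W := by rw [hJJ]; noncomm_ring
      · simpa using hH.conjTranspose_mul_mul_same (bigJ m)
    have h2 : H = -(bigJ m * H * bigJ m) := by
      conv_lhs => rw [hHdef, h1, hJT]
      noncomm_ring
    calc H * bigJ m = -(bigJ m * H * (bigJ m * bigJ m)) := by
          conv_lhs => rw [h2]
          noncomm_ring
      _ = bigJ m * H := by rw [hJJ]; noncomm_ring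
  have hiT : (H⁻¹)ᵀ = H⁻¹ := by rw [Matrix.transpose_nonsing_inv, hT]
  have hi1 : H⁻¹ * H = 1 := Matrix.nonsing_inv_mul H hd
  have hi2 : H * H⁻¹ = 1 := Matrix.mul_nonsing_inv H hd
  have hiJ : bigJ m * H⁻¹ = H⁻¹ * bigJ m := by
    calc bigJ m * H⁻¹ = H⁻¹ * H * (bigJ m * H⁻¹) := by rw [hi1, Matrix.one_mul]
      _ = H⁻¹ * (H * bigJ m) * H⁻¹ := by noncomm_ring
      _ = H⁻¹ * bigJ m * (H * H⁻¹) := by rw [hHJ]; noncomm_ring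
      _ = H⁻¹ * bigJ m := by rw [hi2, Matrix.mul_one]
  set U := W * H⁻¹ with hU
  have hUU : Uᵀ * U = 1 := by
    calc Uᵀ * U = H⁻¹ * (Wᵀ * W) * H⁻¹ := by
          rw [hU, Matrix.transpose_mul, hiT]; noncomm_ring
      _ = (H⁻¹ * H) * (H * H⁻¹) := by rw [← hHH]; noncomm_ring
      _ = 1 := by rw [hi1, hi2, Matrix.one_mul]
  have hUU' : U * Uᵀ = 1 := mul_eq_one_comm.mp hUU
  have hWU : W = U * H := by rw [hU, Matrix.mul_assoc, hi1, Matrix.mul_one]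
  have hUJ : U * bigJ m = bigJ m * U := by
    rw [hU, Matrix.mul_assoc, ← hiJ, ← Matrix.mul_assoc, hW, Matrix.mul_assoc]
  refine ⟨Uᵀ, ⟨?_, ?_⟩, ?_⟩
  · rw [Matrix.mem_orthogonalGroup_iff]
    simpa [Matrix.star_eq_conjTranspose] using hUU
  · have := congrArg Matrix.transpose hUJ
    simpa [Matrix.transpose_mul, hJT] using this.symm
  · have : W * Uᵀ - 1 = U * (H - 1) * Uᵀ := by
      rw [Matrix.mul_sub, Matrix.sub_mul, Matrix.mul_one, hUU', ← hWU]
    rw [this, frobenius_norm_mul_right _ (by simpa using hUU), frobenius_norm_mul_left _ hUU, ← hHH]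
    exact frobenius_norm_sub_one_le_of_posSemidef hH

end Polar

/-! ### Lower bounds for the residual and choice of the rotation -/

section Estimates

attribute [local instance] Matrix.frobeniusNormedSpace

variable {ι : Type*} [Fintype ι] [DecidableEq ι] {m : ℕ}

lemma mul_bigJ_inl {a : Type*} (X : Matrix a (Fin m ⊕ Fin m) ℝ) (i : a) (l : Fin m) :
    (X * bigJ m) i (Sum.inl l) = X i (Sum.inr l) := by
  simp [Matrix.mul_apply, bigJ, Matrix.one_apply]

lemma mul_bigJ_inr {a : Type*} (X : Matrix a (Fin m ⊕ Fin m) ℝ) (i : a) (l : Fin m) :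
    (X * bigJ m) i (Sum.inr l) = -X i (Sum.inl l) := by
  simp [Matrix.mul_apply, bigJ, Matrix.one_apply]

lemma diagonal_kronecker_J2_mul_zero {b : Type*} (u : ι → ℝ) (X : Matrix (ι × Fin 2) b ℝ) (i : ι)
    (l : b) : ((Matrix.diagonal u ⊗ₖ J2) * X) (i, 0) l = -(u i * X (i, 1) l) := by
  simp [Matrix.mul_apply, Fintype.sum_prod_type, J2, Matrix.diagonal_apply, Fin.sum_univ_two]

lemma diagonal_kronecker_J2_mul_one {b : Type*} (u : ι → ℝ) (X : Matrix (ι × Fin 2) b ℝ) (i : ι)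
    (l : b) : ((Matrix.diagonal u ⊗ₖ J2) * X) (i, 1) l = u i * X (i, 0) l := by
  simp [Matrix.mul_apply, Fintype.sum_prod_type, J2, Matrix.diagonal_apply, Fin.sum_univ_two]

/-- The operator decouples into four-dimensional pieces with singular values `|u i - σ|` and `u i +
σ`; the signs of `u i` and `σ` make the former the smaller one. The excess over `(u i - σ)²` times
the squared norm is `2 u i σ ((b₁ + a₂)² + (a₁ - b₂)²)`. -/
lemma gap_mul_frobenius_norm_le (u : ι → ℝ) {σ g : ℝ} (hσ : 0 ≤ σ) (hu : ∀ i, 0 ≤ u i)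
    (hg : 0 ≤ g) (hgap : ∀ i, g ≤ |u i - σ|) (X : Matrix (ι × Fin 2) (Fin m ⊕ Fin m) ℝ) :
    g * ‖X‖ ≤ ‖(Matrix.diagonal u ⊗ₖ J2) * X - σ • (X * bigJ m)‖ := by
  rw [← pow_le_pow_iff_left₀ (by positivity) (norm_nonneg _) two_ne_zero, mul_pow,
    frobenius_norm_sq, frobenius_norm_sq]
  simp only [Fintype.sum_prod_type, Fin.sum_univ_two, Fintype.sum_sum_type, Matrix.sub_apply,
    Matrix.smul_apply, mul_bigJ_inl, mul_bigJ_inr, diagonal_kronecker_J2_mul_zero,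
    diagonal_kronecker_J2_mul_one, smul_eq_mul, ← Finset.sum_add_distrib, Finset.mul_sum]
  refine Finset.sum_le_sum fun i _ => Finset.sum_le_sum fun l _ => ?_
  have h1 : g ^ 2 ≤ (u i - σ) ^ 2 := by
    rw [← sq_abs (u i - σ)]
    exact pow_le_pow_left₀ hg (hgap i) 2
  generalize X (i, 0) (Sum.inl l) = a₁
  generalize X (i, 0) (Sum.inr l) = a₂
  generalize X (i, 1) (Sum.inl l) = b₁
  generalize X (i, 1) (Sum.inr l) = b₂
  have h2 : 0 ≤ u i * σ * ((b₁ + a₂) ^ 2 + (a₁ - b₂) ^ 2) := by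
    have := hu i
    positivity
  have h3 := mul_le_mul_of_nonneg_right h1
    (by positivity : 0 ≤ a₁ ^ 2 + a₂ ^ 2 + (b₁ ^ 2 + b₂ ^ 2))
  linear_combination h3 + 2 * h2

/-- The part of `Y` that anticommutes with `J₂ ⊗ Iₘ`. -/
def antiPart (Y : Matrix (Fin m ⊕ Fin m) (Fin m ⊕ Fin m) ℝ) :
    Matrix (Fin m ⊕ Fin m) (Fin m ⊕ Fin m) ℝ := (1 / 2 : ℝ) • (Y + bigJ m * Y * bigJ m)

lemma bigJ_mul_antiPart (Y : Matrix (Fin m ⊕ Fin m) (Fin m ⊕ Fin m) ℝ) :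
    bigJ m * antiPart Y = (1 / 2 : ℝ) • (bigJ m * Y - Y * bigJ m) := by
  have : bigJ m * (bigJ m * Y * bigJ m) = -(Y * bigJ m) := by
    rw [← Matrix.mul_assoc, ← Matrix.mul_assoc, bigJ_mul_bigJ]
    simp
  rw [antiPart, Matrix.mul_smul, Matrix.mul_add, this, sub_eq_add_neg]

lemma transpose_bigJ_mul_bigJ (m : ℕ) : (bigJ m)ᵀ * bigJ m = 1 := by
  rw [transpose_bigJ, Matrix.neg_mul, bigJ_mul_bigJ, neg_neg]

lemma bigJ_mul_transpose_bigJ (m : ℕ) : bigJ m * (bigJ m)ᵀ = 1 := by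
  rw [transpose_bigJ, Matrix.mul_neg, bigJ_mul_bigJ, neg_neg]

lemma frobenius_norm_antiPart {σ : ℝ} (hσ : 0 ≤ σ)
    (Y : Matrix (Fin m ⊕ Fin m) (Fin m ⊕ Fin m) ℝ) :
    2 * σ * ‖antiPart Y‖ = ‖σ • (bigJ m * Y - Y * bigJ m)‖ := by
  have h := bigJ_mul_antiPart Y
  have : σ • (bigJ m * Y - Y * bigJ m) = (2 * σ) • (bigJ m * antiPart Y) := by
    rw [h, smul_smul]; congr 1; ring
  rw [this, norm_smul, frobenius_norm_mul_left _ (transpose_bigJ_mul_bigJ m), Real.norm_eq_abs,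
    abs_of_nonneg (by positivity)]

/-- Averaging `YᵀY = 1 - XᵀX` with its conjugate by `bigJ m` cancels the cross terms of `Y = W + Z`.
So `WᵀW - 1` is quadratic in `Z` and `X`, and only `Z` enters `Y R - 1` at first order. -/
lemma exists_OSp_frobenius_norm_le {a : Type*} [Fintype a]
    {Y : Matrix (Fin m ⊕ Fin m) (Fin m ⊕ Fin m) ℝ} {X : Matrix a (Fin m ⊕ Fin m) ℝ}
    (hYX : Yᵀ * Y + Xᵀ * X = 1) :
    ∃ R ∈ OSp m, ‖Y * R - 1‖ ≤ ‖antiPart Y‖ +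
      (1 + 2 * ‖(1 : Matrix (Fin m ⊕ Fin m) (Fin m ⊕ Fin m) ℝ)‖) *
        (‖antiPart Y‖ ^ 2 + ‖X‖ ^ 2) := by
  set κ := ‖(1 : Matrix (Fin m ⊕ Fin m) (Fin m ⊕ Fin m) ℝ)‖ with hκ
  have hκ0 : 0 ≤ κ := norm_nonneg _
  set Z := antiPart Y with hZ
  have hJJ := bigJ_mul_bigJ m
  have hJT := transpose_bigJ m
  set P := bigJ m * Y * bigJ m with hP
  have hPn : ‖P‖ = ‖Y‖ := by
    rw [hP, frobenius_norm_mul_right _ (bigJ_mul_transpose_bigJ m),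
      frobenius_norm_mul_left _ (transpose_bigJ_mul_bigJ m)]
  have hPT : Pᵀ * P = -(bigJ m * (Yᵀ * Y) * bigJ m) := by
    calc Pᵀ * P = bigJ m * Yᵀ * (bigJ m * bigJ m) * Y * bigJ m := by
          rw [hP, Matrix.transpose_mul, Matrix.transpose_mul, hJT]; noncomm_ring
      _ = _ := by rw [hJJ]; noncomm_ring
  set W := (1 / 2 : ℝ) • (Y - P) with hW
  have hYWZ : Y = W + Z := by
    rw [hW, hZ, antiPart, ← hP]
    module
  have hYY : Yᵀ * Y = 1 - Xᵀ * X := eq_sub_of_add_eq hYX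
  have hYn : ‖Y‖ ≤ κ := by
    rw [← pow_le_pow_iff_left₀ (norm_nonneg _) hκ0 two_ne_zero, hκ, frobenius_norm_sq_eq_trace,
      frobenius_norm_sq_eq_trace, Matrix.transpose_one, Matrix.one_mul, ← hYX, Matrix.trace_add,
      ← frobenius_norm_sq_eq_trace X]
    nlinarith [sq_nonneg ‖X‖]
  have hWn : ‖W‖ ≤ κ := by
    rw [hW, norm_smul]
    have := norm_sub_le Y P
    norm_num
    linarith
  have hWZ : Wᵀ * W + Zᵀ * Z = (1 / 2 : ℝ) • (Yᵀ * Y + Pᵀ * P) := by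
    rw [hW, hZ, antiPart, ← hP]
    simp only [Matrix.transpose_smul, Matrix.transpose_sub, Matrix.transpose_add,
      Matrix.smul_mul, Matrix.mul_smul, Matrix.sub_mul, Matrix.add_mul, Matrix.mul_sub,
      Matrix.mul_add]
    module
  have hWW : Wᵀ * W - 1 =
      -(Zᵀ * Z + (1 / 2 : ℝ) • (Xᵀ * X - bigJ m * (Xᵀ * X) * bigJ m)) := by
    have h1 : Wᵀ * W = (1 / 2 : ℝ) • (Yᵀ * Y + Pᵀ * P) - Zᵀ * Z := eq_sub_of_add_eq hWZ
    have h2 : bigJ m * (1 - Xᵀ * X) * bigJ m = -1 - bigJ m * (Xᵀ * X) * bigJ m := by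
      rw [Matrix.mul_sub, Matrix.sub_mul, Matrix.mul_one, hJJ]
    rw [h1, hPT, hYY, h2]
    module
  have ht : ‖Wᵀ * W - 1‖ ≤ ‖Z‖ ^ 2 + ‖X‖ ^ 2 := by
    rw [hWW, norm_neg]
    refine (norm_add_le _ _).trans (add_le_add (frobenius_norm_transpose_mul_self_le Z) ?_)
    have h1 := norm_sub_le (Xᵀ * X) (bigJ m * (Xᵀ * X) * bigJ m)
    rw [frobenius_norm_mul_right _ (bigJ_mul_transpose_bigJ m),
      frobenius_norm_mul_left _ (transpose_bigJ_mul_bigJ m)] at h1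
    have h2 := frobenius_norm_transpose_mul_self_le X
    rw [norm_smul]
    norm_num
    linarith
  have hWJ : W * bigJ m = bigJ m * W := by
    have h1 : P * bigJ m = -(bigJ m * Y) := by
      rw [hP, Matrix.mul_assoc, hJJ]; simp
    have h2 : bigJ m * P = -(Y * bigJ m) := by
      rw [hP, ← Matrix.mul_assoc, ← Matrix.mul_assoc, hJJ]; simp
    rw [hW, Matrix.smul_mul, Matrix.mul_smul, Matrix.sub_mul, Matrix.mul_sub, h1, h2]
    module
  set t := ‖Z‖ ^ 2 + ‖X‖ ^ 2 with htdef
  -- For `t < 1` the polar factor gives the bound `t`. For `t ≥ 1` even `R = 1` works, as `‖W - 1‖ ≤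
  -- 2κ`; this is the source of the constant `1 + 2κ`, and it spares any smallness assumption.
  obtain ⟨R, hR, hWR⟩ : ∃ R ∈ OSp m, ‖W * R - 1‖ ≤ (1 + 2 * κ) * t := by
    have ht0 : 0 ≤ t := by positivity
    rcases lt_or_ge t 1 with h | h
    · obtain ⟨R, hR, hWR⟩ := exists_OSp_frobenius_norm_mul_sub_one_le hWJ (ht.trans_lt h)
      exact ⟨R, hR, by nlinarith⟩
    · refine ⟨1, one_mem_OSp m, ?_⟩
      rw [Matrix.mul_one]
      have := norm_sub_le W 1
      nlinarith
  refine ⟨R, hR, ?_⟩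
  have hZR : ‖Z * R‖ = ‖Z‖ := frobenius_norm_mul_right _
    (by simpa [Matrix.star_eq_conjTranspose] using (Matrix.mem_orthogonalGroup_iff _ _).mp hR.1) _
  have : Y * R - 1 = Z * R + (W * R - 1) := by
    rw [hYWZ, Matrix.add_mul]; abel
  rw [this, ← hZR]
  exact (norm_add_le _ _).trans (add_le_add le_rfl hWR)

end Estimates

/-! ### Reduction to Schur coordinates -/

section Reduction

variable {p m : ℕ} {J : Finset (Fin p)}

/-- `Fin m ⊕ Fin m` as the entries of `m` blocks of size two. -/
def sumEquivProdFinTwo (m : ℕ) : Fin m ⊕ Fin m ≃ Fin m × Fin 2 where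
  toFun := Sum.elim (fun k => (k, 0)) fun k => (k, 1)
  invFun x := if x.2 = 0 then Sum.inl x.1 else Sum.inr x.1
  left_inv := by rintro (k | k) <;> simp
  right_inv := by
    rintro ⟨k, t⟩
    fin_cases t <;> simp

/-- The coordinates, with those of the blocks in `J` first, ordered as the columns of `V` are. -/
def splitEquiv (e : Fin m ≃ {j // j ∈ J}) :
    (Fin m ⊕ Fin m) ⊕ ({i // i ∉ J} × Fin 2) ≃ Fin (2 * p) :=
  (((Equiv.sumCongr ((sumEquivProdFinTwo m).trans (e.prodCongr (Equiv.refl _)))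
    (Equiv.refl _)).trans (Equiv.sumProdDistrib _ _ _).symm).trans
      ((Equiv.sumCompl (· ∈ J)).prodCongr (Equiv.refl _))).trans (blockIndex p)

lemma splitEquiv_inl_inl (e : Fin m ≃ {j // j ∈ J}) (k : Fin m) :
    splitEquiv e (Sum.inl (Sum.inl k)) = blockIndex p (e k, 0) := rfl

lemma splitEquiv_inl_inr (e : Fin m ≃ {j // j ∈ J}) (k : Fin m) :
    splitEquiv e (Sum.inl (Sum.inr k)) = blockIndex p (e k, 1) := rfl

lemma splitEquiv_inr (e : Fin m ≃ {j // j ∈ J}) (x : {i // i ∉ J} × Fin 2) :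
    splitEquiv e (Sum.inr x) = blockIndex p (x.1, x.2) := rfl

lemma schurForm_blockIndex (lam θ : Fin p → ℝ) (x y : Fin p × Fin 2) :
    schurForm lam θ (blockIndex p x) (blockIndex p y) =
      Matrix.diagonal (fun j => lam j * Real.cos (θ j)) x.1 y.1 *
        (1 : Matrix (Fin 2) (Fin 2) ℝ) x.2 y.2 +
      Matrix.diagonal (fun j => lam j * Real.sin (θ j)) x.1 y.1 * J2 x.2 y.2 := by
  simp [schurForm]

/-- The two summands are the symmetric and the skew part; on the blocks of `J` the latter is exactly
`σ • bigJ m`. -/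
lemma schurForm_submatrix (lam θ : Fin p → ℝ) {σ : ℝ}
    (hJ : ∀ j ∈ J, lam j * Real.sin (θ j) = σ) (e : Fin m ≃ {j // j ∈ J}) :
    (schurForm lam θ).submatrix (splitEquiv e) (splitEquiv e) =
      Matrix.fromBlocks (Matrix.diagonal (Sum.elim (fun k => lam (e k) * Real.cos (θ (e k)))
          fun k => lam (e k) * Real.cos (θ (e k)))) 0 0
        (Matrix.diagonal fun x : {i // i ∉ J} × Fin 2 => lam x.1 * Real.cos (θ x.1)) +
      Matrix.fromBlocks (σ • bigJ m) 0 0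
        (Matrix.diagonal (fun i : {i // i ∉ J} => lam i * Real.sin (θ i)) ⊗ₖ J2) := by
  have hσ : ∀ k, lam (e k) * Real.sin (θ (e k)) = σ := fun k => hJ _ (e k).2
  have hne : ∀ (k : Fin m) (x : {i // i ∉ J}), (e k : Fin p) ≠ x := fun k x h =>
    x.2 (h ▸ (e k).2)
  have hinj : ∀ k l : Fin m, (e k : Fin p) = e l ↔ k = l := fun k l => by
    rw [Subtype.coe_inj, e.apply_eq_iff_eq]
  ext x y
  rw [Matrix.submatrix_apply]
  rcases x with (k | k) | ⟨i, s⟩ <;> rcases y with (l | l) | ⟨j, t⟩ <;>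
    simp only [splitEquiv_inl_inl, splitEquiv_inl_inr, splitEquiv_inr, schurForm_blockIndex,
      Matrix.add_apply, Matrix.fromBlocks_apply₁₁, Matrix.fromBlocks_apply₁₂,
      Matrix.fromBlocks_apply₂₁, Matrix.fromBlocks_apply₂₂, Matrix.kroneckerMap_apply, bigJ, J2,
      Matrix.smul_apply, Matrix.diagonal_apply, hinj, hne, (hne _ _).symm, Subtype.coe_inj, hσ] <;>
    simp [Matrix.one_apply]
  split_ifs <;> simp_all

lemma fromRows_sub {a b c : Type*} (M M' : Matrix a c ℝ) (N N' : Matrix b c ℝ) :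
    Matrix.fromRows M N - Matrix.fromRows M' N' = Matrix.fromRows (M - M') (N - N') := by
  ext (i | i) j <;> rfl

lemma targetBlock_eq (d : Fin m → ℝ) (σ : ℝ) :
    targetBlock d σ = Matrix.diagonal (Sum.elim d d) + σ • bigJ m := by
  rw [targetBlock, bigJ, Matrix.fromBlocks_smul, ← Matrix.fromBlocks_diagonal,
    Matrix.fromBlocks_add]
  simp

lemma transpose_J2 : J2ᵀ = -J2 := by
  ext i j
  fin_cases i <;> fin_cases j <;> simp [J2]

lemma skewPart_conj {a b : Type*} [Fintype b] (U : Matrix a b ℝ) {C L : Matrix b b ℝ}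
    (hC : Cᵀ = C) (hL : Lᵀ = -L) : skewPart (U * (C + L) * Uᵀ) = U * L * Uᵀ := by
  have : U * (C + L) * Uᵀ - (U * (C + L) * Uᵀ)ᵀ = (2 : ℝ) • (U * L * Uᵀ) := by
    rw [Matrix.transpose_mul, Matrix.transpose_mul, Matrix.transpose_add, hC, hL,
      Matrix.transpose_transpose, ← Matrix.mul_assoc]
    simp only [Matrix.mul_add, Matrix.add_mul, Matrix.mul_neg, Matrix.neg_mul]
    module
  rw [skewPart, this, smul_smul]
  norm_num

lemma frobenius_norm_eq_of_isRSD {A Q : Matrix (Fin (2 * p)) (Fin (2 * p)) ℝ} {lam θ : Fin p → ℝ}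
    (h : IsRSD A Q lam θ) : ‖A‖ = ‖schurForm lam θ‖ := by
  have h1 : Qᵀ * Q = 1 := by
    simpa [Matrix.star_eq_conjTranspose] using (Matrix.mem_orthogonalGroup_iff' _ _).mp h.orthogonal
  rw [h.eq, frobenius_norm_mul_right _ (by simpa using h1), frobenius_norm_mul_left _ h1]

/-- The bound for a fixed residual `δ`, before `δ` is expressed through `ε`. -/
lemma exists_OSp_residual_le {lam θ : Fin p → ℝ} {σ : ℝ}
    (hJ : ∀ j ∈ J, lam j * Real.sin (θ j) = σ) (hJc : ∀ i ∉ J, lam i * Real.sin (θ i) ≠ σ)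
    (hm : 0 < m) {A Q : Matrix (Fin (2 * p)) (Fin (2 * p)) ℝ} (hA : IsRSD A Q lam θ)
    (e : Fin m ≃ {j // j ∈ J}) {V : Matrix (Fin (2 * p)) (Fin m ⊕ Fin m) ℝ} (hV : V ∈ stiefel p m)
    {δ : ℝ} (hδ : ‖skewPart A * V - V * (σ • bigJ m)‖ ≤ δ) :
    ∃ R ∈ OSp m, ‖A * (V * R) - (V * R) *
        targetBlock (fun k => lam (e k) * Real.cos (θ (e k))) σ‖ ≤
      δ * (1 + outerSpread lam θ J / imagGap lam θ J σ + innerSpread lam θ J / σ) +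
        innerSpread lam θ J *
          (1 + 2 * ‖(1 : Matrix (Fin m ⊕ Fin m) (Fin m ⊕ Fin m) ℝ)‖) *
          ((1 / (2 * σ)) ^ 2 + (1 / imagGap lam θ J σ) ^ 2) * δ ^ 2 := by
  have hpos : ∀ i, 0 < lam i * Real.sin (θ i) := fun i =>
    mul_pos (hA.lam_pos i) (Real.sin_pos_of_mem_Ioo (hA.angle_mem i))
  have hσ : 0 < σ := by
    rw [← hJ _ (e ⟨0, hm⟩).2]
    exact hpos _
  set d : Fin m → ℝ := fun k => lam (e k) * Real.cos (θ (e k)) with hd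
  set inn := innerSpread lam θ J with hinn
  set out := outerSpread lam θ J with hout
  set g := imagGap lam θ J σ with hg
  set κ := ‖(1 : Matrix (Fin m ⊕ Fin m) (Fin m ⊕ Fin m) ℝ)‖ with hκ
  set c : {i // i ∉ J} × Fin 2 → ℝ := fun x => lam x.1 * Real.cos (θ x.1) with hc
  set u : {i // i ∉ J} → ℝ := fun i => lam i * Real.sin (θ i) with hu
  have hδ0 : 0 ≤ δ := (norm_nonneg _).trans hδ
  have hinn0 : 0 ≤ inn := Real.iSup_nonneg fun _ => abs_nonneg _
  have hout0 : 0 ≤ out := Real.iSup_nonneg fun _ => abs_nonneg _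
  have hg0 : 0 ≤ g := Real.iInf_nonneg fun _ => abs_nonneg _
  have hinnle : ∀ k l, |d k - d l| ≤ inn := fun k l =>
    le_ciSup (f := fun jj : {j // j ∈ J} × {j // j ∈ J} =>
      |lam jj.1 * Real.cos (θ jj.1) - lam jj.2 * Real.cos (θ jj.2)|)
      (Set.finite_range _).bddAbove (e k, e l)
  have houtle : ∀ x l, |c x - d l| ≤ out := fun x l =>
    le_ciSup (f := fun ij : {i // i ∉ J} × {j // j ∈ J} =>
      |lam ij.1 * Real.cos (θ ij.1) - lam ij.2 * Real.cos (θ ij.2)|)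
      (Set.finite_range _).bddAbove (x.1, e l)
  have hgle : ∀ i, g ≤ |u i - σ| := fun i =>
    ciInf_le (f := fun i : {i // i ∉ J} => |lam i * Real.sin (θ i) - σ|)
      (Set.finite_range _).bddBelow i
  set ψ := splitEquiv e with hψ
  set U := Q.submatrix id ψ with hU
  have hQ1 : Qᵀ * Q = 1 := by
    simpa [Matrix.star_eq_conjTranspose] using
      (Matrix.mem_orthogonalGroup_iff' _ _).mp hA.orthogonal
  have hQ2 : Q * Qᵀ = 1 := mul_eq_one_comm.mp hQ1
  have hUT : Uᵀ = Qᵀ.submatrix ψ id := rfl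
  have hU1 : Uᵀ * U = 1 := by
    rw [hUT, hU, ← Matrix.submatrix_mul _ _ _ id _ Function.bijective_id, hQ1,
      Matrix.submatrix_one_equiv]
  have hU2 : U * Uᵀ = 1 := by
    rw [hUT, hU, Matrix.submatrix_mul_equiv, hQ2, Matrix.submatrix_id_id]
  set D : Matrix (Fin m ⊕ Fin m) (Fin m ⊕ Fin m) ℝ := Matrix.diagonal (Sum.elim d d) with hD
  set C := Matrix.fromBlocks D 0 0 (Matrix.diagonal c) with hC
  set L := Matrix.fromBlocks (σ • bigJ m) 0 0 (Matrix.diagonal u ⊗ₖ J2) with hL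
  have hAU : A = U * (C + L) * Uᵀ := by
    rw [← schurForm_submatrix lam θ hJ e, hUT, hU, Matrix.submatrix_mul_equiv,
      Matrix.submatrix_mul_equiv, Matrix.submatrix_id_id, ← hA.eq]
  have hskew : skewPart A = U * L * Uᵀ := by
    rw [hAU]
    apply skewPart_conj
    · simp [hC, hD]
    · simp [hL, Matrix.fromBlocks_transpose, Matrix.fromBlocks_neg, transpose_bigJ,
        ← Matrix.kroneckerMap_transpose, transpose_J2]
      ext x y
      simp
  set B := Uᵀ * V with hB
  have hVB : V = U * B := by rw [hB, ← Matrix.mul_assoc, hU2, Matrix.one_mul]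
  set Y := B.toRows₁ with hY
  set X := B.toRows₂ with hX
  have hBYX : B = Matrix.fromRows Y X := (Matrix.fromRows_toRows B).symm
  have hYX : Yᵀ * Y + Xᵀ * X = 1 := by
    have h1 : Bᵀ * B = 1 := by
      calc Bᵀ * B = Vᵀ * (U * Uᵀ) * V := by
            rw [hB, Matrix.transpose_mul, Matrix.transpose_transpose]
            simp only [Matrix.mul_assoc]
        _ = 1 := by rw [hU2, Matrix.mul_one]; exact hV
    rwa [hBYX, Matrix.transpose_fromRows, Matrix.fromCols_mul_fromRows] at h1
  have hLB : L * B - B * (σ • bigJ m) = Matrix.fromRows (σ • (bigJ m * Y - Y * bigJ m))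
      ((Matrix.diagonal u ⊗ₖ J2) * X - σ • (X * bigJ m)) := by
    rw [hBYX, hL, Matrix.fromBlocks_mul_fromRows, Matrix.fromRows_mul, fromRows_sub]
    simp [smul_sub]
  have hres : skewPart A * V - V * (σ • bigJ m) = U * (L * B - B * (σ • bigJ m)) := by
    rw [hskew, Matrix.mul_sub, ← Matrix.mul_assoc U B, ← hVB, hB]
    simp only [Matrix.mul_assoc]
  have hE : ‖L * B - B * (σ • bigJ m)‖ ≤ δ := by
    rwa [hres, frobenius_norm_mul_left _ hU1] at hδ
  have hE2 := frobenius_norm_sq_fromRows (σ • (bigJ m * Y - Y * bigJ m))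
      ((Matrix.diagonal u ⊗ₖ J2) * X - σ • (X * bigJ m))
  rw [← hLB] at hE2
  have hZ : ‖antiPart Y‖ ≤ 1 / (2 * σ) * δ := by
    have h1 := frobenius_norm_antiPart hσ.le Y
    have h2 : ‖σ • (bigJ m * Y - Y * bigJ m)‖ ≤ δ := by
      refine (pow_le_pow_iff_left₀ (norm_nonneg _) hδ0 two_ne_zero).mp ?_
      nlinarith [norm_nonneg (L * B - B * (σ • bigJ m)),
        sq_nonneg ‖(Matrix.diagonal u ⊗ₖ J2) * X - σ • (X * bigJ m)‖]
    rw [← h1] at h2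
    rw [div_mul_eq_mul_div, one_mul, le_div_iff₀ (by positivity)]
    linarith
  have hXn : ‖X‖ ≤ 1 / g * δ := by
    -- Without outer blocks the gap takes the default value `0`, but then `X` has no rows.
    rcases isEmpty_or_nonempty {i // i ∉ J} with hI | hI
    · have : X = 0 := by ext x; exact isEmptyElim x.1
      rw [this, norm_zero]
      positivity
    · have hgpos : 0 < g := by
        obtain ⟨i, hi⟩ := exists_eq_ciInf_of_finite (f := fun i : {i // i ∉ J} => |u i - σ|)
        have : g = |u i - σ| := hi.symm
        rw [this]
        exact abs_pos.mpr (sub_ne_zero.mpr (hJc i i.2))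
      have h1 := gap_mul_frobenius_norm_le u hσ.le (fun i => (hpos i).le) hg0 hgle X
      have h2 : ‖(Matrix.diagonal u ⊗ₖ J2) * X - σ • (X * bigJ m)‖ ≤ δ := by
        refine (pow_le_pow_iff_left₀ (norm_nonneg _) hδ0 two_ne_zero).mp ?_
        nlinarith [norm_nonneg (L * B - B * (σ • bigJ m)),
          sq_nonneg ‖σ • (bigJ m * Y - Y * bigJ m)‖]
      rw [div_mul_eq_mul_div, one_mul, le_div_iff₀ hgpos]
      linarith
  obtain ⟨R, hR, hYR⟩ := exists_OSp_frobenius_norm_le hYX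
  rw [← hκ] at hYR
  have hRR : R * Rᵀ = 1 := by
    simpa [Matrix.star_eq_conjTranspose] using (Matrix.mem_orthogonalGroup_iff _ _).mp hR.1
  refine ⟨R, hR, ?_⟩
  -- The commutation of `R` with `bigJ m` turns the skew part into the old residual times `R`.
  -- Replacing `Y R` by `Y R - 1` is free, since `D` commutes with `1`.
  have hsplit : A * (V * R) - (V * R) * targetBlock d σ =
      U * ((L * B - B * (σ • bigJ m)) * R + Matrix.fromRows
        (D * (Y * R - 1) - (Y * R - 1) * D) (Matrix.diagonal c * (X * R) - X * R * D)) := by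
    have h1 : Matrix.fromRows (D * (Y * R - 1) - (Y * R - 1) * D)
        (Matrix.diagonal c * (X * R) - X * R * D) = C * B * R - B * R * D := by
      rw [hBYX, hC, Matrix.fromBlocks_mul_fromRows, Matrix.fromRows_mul, Matrix.fromRows_mul,
        Matrix.fromRows_mul, fromRows_sub]
      simp only [Matrix.zero_mul, add_zero, zero_add, Matrix.mul_assoc, Matrix.mul_sub,
        Matrix.sub_mul, Matrix.mul_one, Matrix.one_mul, sub_sub_sub_cancel_right]
    have h2 : A * (V * R) = U * ((C + L) * B * R) := by
      rw [hAU, hB]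
      simp only [Matrix.mul_assoc]
    have h3 : B * (σ • bigJ m) * R = B * R * (σ • bigJ m) := by
      rw [Matrix.mul_assoc, Matrix.smul_mul, ← hR.2, ← Matrix.mul_smul, ← Matrix.mul_assoc]
    have h4 : V * R * targetBlock d σ = U * (B * R * D + B * R * (σ • bigJ m)) := by
      rw [targetBlock_eq, hVB, ← hD, ← Matrix.mul_add]
      simp only [Matrix.mul_assoc]
    rw [h1, h2, h4, Matrix.sub_mul, h3, ← Matrix.mul_sub, Matrix.add_mul, Matrix.add_mul]
    congr 1
    abel
  have hn1 : ‖D * (Y * R - 1) - (Y * R - 1) * D‖ ≤ inn * ‖Y * R - 1‖ :=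
    frobenius_norm_diagonal_sub_le _ _ _ hinn0 (by rintro (k | k) (l | l) <;> exact hinnle k l)
  have hn2 : ‖Matrix.diagonal c * (X * R) - X * R * D‖ ≤ out * ‖X‖ := by
    have := frobenius_norm_diagonal_sub_le c (Sum.elim d d) (X * R) hout0
      (by rintro x (l | l) <;> exact houtle x l)
    rwa [frobenius_norm_mul_right _ hRR] at this
  rw [hsplit, frobenius_norm_mul_left _ hU1]
  have hn3 := norm_add_le ((L * B - B * (σ • bigJ m)) * R) (Matrix.fromRows
        (D * (Y * R - 1) - (Y * R - 1) * D) (Matrix.diagonal c * (X * R) - X * R * D))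
  have hn4 := frobenius_norm_fromRows_le (D * (Y * R - 1) - (Y * R - 1) * D)
    (Matrix.diagonal c * (X * R) - X * R * D)
  rw [frobenius_norm_mul_right _ hRR] at hn3
  have hκ0 : 0 ≤ κ := norm_nonneg _
  have hYR' : ‖Y * R - 1‖ ≤ 1 / σ * δ +
      (1 + 2 * κ) * ((1 / (2 * σ)) ^ 2 + (1 / g) ^ 2) * δ ^ 2 := by
    have h1 : ‖antiPart Y‖ ^ 2 ≤ (1 / (2 * σ) * δ) ^ 2 := pow_le_pow_left₀ (norm_nonneg _) hZ 2
    have h2 : ‖X‖ ^ 2 ≤ (1 / g * δ) ^ 2 := pow_le_pow_left₀ (norm_nonneg _) hXn 2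
    -- A factor `2` is given away here to match the stated bound.
    have h3 : 1 / (2 * σ) * δ ≤ 1 / σ * δ := by
      gcongr
      linarith
    have h4 : (1 + 2 * κ) * (‖antiPart Y‖ ^ 2 + ‖X‖ ^ 2) ≤
        (1 + 2 * κ) * ((1 / (2 * σ) * δ) ^ 2 + (1 / g * δ) ^ 2) := by gcongr
    calc _ ≤ 1 / σ * δ + (1 + 2 * κ) * ((1 / (2 * σ) * δ) ^ 2 + (1 / g * δ) ^ 2) := by linarith
      _ = _ := by ring
  have hn5 := mul_le_mul_of_nonneg_left hYR' hinn0
  have hn6 := mul_le_mul_of_nonneg_left hXn hout0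
  calc _ ≤ δ + (inn * (1 / σ * δ + (1 + 2 * κ) * ((1 / (2 * σ)) ^ 2 + (1 / g) ^ 2) * δ ^ 2) +
        out * (1 / g * δ)) := by linarith
    _ = _ := by ring

end Reduction

end NormalEVP

end

/-! ### The main theorem -/

theorem mainTheorem4 {p m : ℕ} (lam θ : Fin p → ℝ) (J : Finset (Fin p)) (σ τ : ℝ)
    (hJ : ∀ j ∈ J, lam j * Real.sin (θ j) = σ)
    (hJc : ∀ i ∉ J, lam i * Real.sin (θ i) ≠ σ) :
    ∃ r : ℝ → ℝ, r =o[𝓝[>] 0] (fun ε : ℝ => ε) ∧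
      ∀ A Q : Matrix (Fin (2 * p)) (Fin (2 * p)) ℝ, NormalEVP.IsRSD A Q lam θ →
      ∀ e : Fin m ≃ {j // j ∈ J},
      ∀ ε : ℝ, 0 < ε → ∀ V ∈ NormalEVP.stiefel p m,
        ‖NormalEVP.skewPart A * V - V * (σ • NormalEVP.bigJ m)‖ ≤ τ * ε * ‖A‖ →
        ∃ μ : ℝ,
          IsLeast ((fun R => ‖A * (V * R) - (V * R) *
              NormalEVP.targetBlock (fun k => lam (e k) * Real.cos (θ (e k))) σ‖) ''
            NormalEVP.OSp m) μ ∧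
          μ ≤ τ * ε * ‖A‖ *
              (1 + NormalEVP.outerSpread lam θ J / NormalEVP.imagGap lam θ J σ
                + NormalEVP.innerSpread lam θ J / σ) + r ε := by
  -- The quadratic remainder with `δ = τ ε ‖A‖`. Writing `‖A‖` as the norm of the Schur form makes
  -- `K` independent of `A`, `Q` and `V`.
  set K := NormalEVP.innerSpread lam θ J *
    (1 + 2 * ‖(1 : Matrix (Fin m ⊕ Fin m) (Fin m ⊕ Fin m) ℝ)‖) *
    ((1 / (2 * σ)) ^ 2 + (1 / NormalEVP.imagGap lam θ J σ) ^ 2) *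
    (τ * ‖NormalEVP.schurForm lam θ‖) ^ 2 with hK
  have hinn0 : 0 ≤ NormalEVP.innerSpread lam θ J := Real.iSup_nonneg fun _ => abs_nonneg _
  have hK0 : 0 ≤ K := by positivity
  refine ⟨fun ε => K * ε ^ 2, ?_, ?_⟩
  · have h : (fun ε : ℝ => ε ^ 2) =o[𝓝 0] fun ε : ℝ => ε := by
      simpa using isLittleO_pow_pow (𝕜 := ℝ) one_lt_two
    exact (h.const_mul_left K).mono nhdsWithin_le_nhds
  intro A Q hA e ε hε V hV hres
  set f : Matrix (Fin m ⊕ Fin m) (Fin m ⊕ Fin m) ℝ → ℝ := fun R => ‖A * (V * R) - (V * R) *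
    NormalEVP.targetBlock (fun k => lam (e k) * Real.cos (θ (e k))) σ‖ with hf
  have hcont : Continuous f := by
    have : Continuous fun R : Matrix (Fin m ⊕ Fin m) (Fin m ⊕ Fin m) ℝ => A * (V * R) - (V * R) *
        NormalEVP.targetBlock (fun k => lam (e k) * Real.cos (θ (e k))) σ := by fun_prop
    exact continuous_norm.comp this
  have hcpt := (NormalEVP.isCompact_OSp m).image hcont
  obtain ⟨μ, hμ⟩ := hcpt.exists_isLeast ⟨_, Set.mem_image_of_mem f (NormalEVP.one_mem_OSp m)⟩
  refine ⟨μ, hμ, ?_⟩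
  suffices h : ∃ R ∈ NormalEVP.OSp m, f R ≤ τ * ε * ‖A‖ *
      (1 + NormalEVP.outerSpread lam θ J / NormalEVP.imagGap lam θ J σ
        + NormalEVP.innerSpread lam θ J / σ) + K * ε ^ 2 by
    obtain ⟨R, hR, hle⟩ := h
    exact (hμ.2 (Set.mem_image_of_mem f hR)).trans hle
  -- For `m = 0` nothing forces `σ > 0`, but the matrices have no columns and the inner spread
  -- vanishes. As `τ` has no assumed sign, `0 ≤ τ ε ‖A‖` is read off the residual hypothesis.
  rcases Nat.eq_zero_or_pos m with rfl | hm
  · refine ⟨1, NormalEVP.one_mem_OSp 0, ?_⟩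
    have hemp : IsEmpty {j // j ∈ J} := e.symm.isEmpty
    have h0 : f 1 = 0 := by
      rw [hf]
      exact norm_eq_zero.mpr (by ext _ x; exact isEmptyElim x)
    have h1 : NormalEVP.innerSpread lam θ J = 0 := Real.iSup_of_isEmpty _
    have h2 : 0 ≤ NormalEVP.outerSpread lam θ J := Real.iSup_nonneg fun _ => abs_nonneg _
    have h3 : 0 ≤ NormalEVP.imagGap lam θ J σ := Real.iInf_nonneg fun _ => abs_nonneg _
    have h4 := (norm_nonneg _).trans hres
    rw [h0, h1, zero_div, add_zero]
    positivity
  · obtain ⟨R, hR, hle⟩ := NormalEVP.exists_OSp_residual_le hJ hJc hm hA e hV hres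
    refine ⟨R, hR, hle.trans_eq ?_⟩
    rw [hK, NormalEVP.frobenius_norm_eq_of_isRSD hA]
    ring
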